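/- Conventions. A subset $D$ of a linear order $L$ is dense in $L$ if for all $x<y$ in $L$ there is $d\in D$ with $x\le d\le y$; the density of $L$ is the least cardinality of a dense subset of $L$. For a cardinal $\mu$, ${\rm Ded}^+(\mu)$ is the least cardinal $\theta$ such that there is no linear order with $\theta$ elements and density $\le\mu$. For a regular cardinal $\kappa$, $J^{\rm bd}_\kappa$ is the ideal of bounded subsets of $\kappa$, and ${\bf U}_{J^{\rm bd}_\kappa}(\chi)$ is the least cardinality of a family $\mathcal A$ of subsets of $\chi$, each of cardinality $\kappa$, such that for every $f:\kappa\to\chi$ there is $A\in\mathcal A$ with $\{i<\kappa: f(i)\in A\}\notin J^{\rm bd}_\kappa$. A sequence $\langle \mathcal I_\alpha:\alpha<\lambda\rangle$ of linear orders, each of cardinality $\kappa$, is entangled if for all $n<\omega$, all $\alpha_1<\dots<\alpha_n<\lambda$, all $t^\ell_\zeta\in\mathcal I_{\alpha_\ell}$ ($1\le\ell\le n$, $\zeta<\kappa$) with $t^\ell_\zeta\ne t^\ell_\xi$ whenever $\zeta\neq\xi$, and all $w\subseteq\{1,\dots,n\}$, there are $\zeta<\xi<\kappa$ such that $t^\ell_\zeta<t^\ell_\xi$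 in $\mathcal I_{\alpha_\ell}$ for every $\ell\in w$ and $t^\ell_\xi<t^\ell_\zeta$ in $\mathcal I_{\alpha_\ell}$ for every $\ell\in\{1,\dots,n\}\setminus w$. ${\rm Ens}(\kappa,\lambda)$ is the statement that there is an entangled sequence $\langle \mathcal I_\alpha:\alpha<\lambda\rangle$ of linear orders, each of cardinality $\kappa$. Theorem 3.1. Let $\mu,\kappa,\chi,\lambda$ be cardinals such that $\mu<\kappa<\chi<{\rm Ded}^+(\mu)$, $2^\mu<\lambda$, $\kappa$ is regular (in particular infinite) and $\lambda\le{\bf U}_{J^{\rm bd}_\kappa}(\chi)$. Then ${\rm Ens}(\kappa,\lambda)$ holds, and it is witnessed by an entangled sequence $\langle\mathcal I_\alpha:\alpha<\lambda\rangle$ of linear orders each of which has cardinality $\kappa$ and density $\mu$. -/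

import Mathlib

open Cardinal Set

universe u v w

/-- `D` is dense in the linear order `L`: whenever `x < y` there is `d ∈ D` with `x ≤ d ≤ y`. -/
def IsOrderDense {L : Type u} [LinearOrder L] (D : Set L) : Prop :=
  ∀ x y : L, x < y → ∃ d ∈ D, x ≤ d ∧ d ≤ y

/-- The density of a linear order: the least cardinality of a dense subset. -/
noncomputable def orderDensity (L : Type u) [LinearOrder L] : Cardinal.{u} :=
  sInf {θ : Cardinal.{u} | ∃ D : Set L, IsOrderDense D ∧ #D = θ}

/-- `Ded⁺(μ)`: the least cardinal `θ` such that there is no linear order with `θ` elements and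
density at most `μ`. -/
noncomputable def dedPlus (μ : Cardinal.{u}) : Cardinal.{u} :=
  sInf {θ : Cardinal.{u} |
    ¬ ∃ (L : Type u) (_ : LinearOrder L), #L = θ ∧ orderDensity L ≤ μ}

/-- The ideal `J^bd` of bounded subsets of a linear order `K` (used for `K` a cardinal without
last element): `s` is bounded if all its elements are below some `a : K`. The disjunct `s = ∅`
only matters for empty `K`. -/
def boundedIdeal (K : Type u) [LinearOrder K] : Order.Ideal (Set K) where
  carrier := {s | s = ∅ ∨ ∃ a : K, ∀ x ∈ s, x < a}
  lower' := by
    rintro s t hts (rfl | ⟨a, ha⟩)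
    · exact Or.inl (Set.subset_empty_iff.mp hts)
    · exact Or.inr ⟨a, fun x hx => ha x (hts hx)⟩
  nonempty' := ⟨∅, Or.inl rfl⟩
  directed' := by
    rintro s (rfl | ⟨a, ha⟩) t ht
    · exact ⟨t, ht, Set.empty_subset t, le_rfl⟩
    · rcases ht with rfl | ⟨b, hb⟩
      · exact ⟨s, Or.inr ⟨a, ha⟩, le_rfl, Set.empty_subset s⟩
      · refine ⟨s ∪ t, Or.inr ⟨max a b, ?_⟩, Set.subset_union_left, Set.subset_union_right⟩
        rintro x (hx | hx)
        · exact lt_max_of_lt_left (ha x hx)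
        · exact lt_max_of_lt_right (hb x hx)

/-- `U_J(χ)` for an ideal `J` on `K`, where `K` has cardinality `κ`: the least cardinality of a
family `A` of subsets of `χ`, each of cardinality `κ`, such that for every `f : K → χ` there is
`a ∈ A` with `{i | f i ∈ a}` not in `J`. -/
noncomputable def coveringU {K : Type u} (J : Order.Ideal (Set K)) (χ : Cardinal.{u}) :
    Cardinal.{u} :=
  sInf {θ : Cardinal.{u} | ∃ A : Set (Set χ.ord.ToType), #A = θ ∧ (∀ a ∈ A, #a = #K) ∧
    ∀ f : K → χ.ord.ToType, ∃ a ∈ A, {i : K | f i ∈ a} ∉ J}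

/-- A sequence `I` of linear orders is `κ`-entangled. The parameter `a` lists the indices
`α₁ < ⋯ < αₙ`, and `t ℓ ζ` (for `ζ < κ`) are pairwise distinct elements of the `ℓ`-th order. -/
def IsKEntangled {ι : Type w} [LinearOrder ι] (κ : Cardinal.{v}) (I : ι → Type v)
    [∀ α, LinearOrder (I α)] : Prop :=
  (∀ α, κ ≤ #(I α)) ∧
  ∀ (n : ℕ) (a : Fin n → ι), StrictMono a →
    ∀ t : ∀ ℓ : Fin n, κ.ord.ToType → I (a ℓ), (∀ ℓ, Function.Injective (t ℓ)) →
      ∀ s : Set (Fin n), ∃ ζ ξ : κ.ord.ToType, ζ < ξ ∧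
        (∀ ℓ ∈ s, t ℓ ζ < t ℓ ξ) ∧ (∀ ℓ ∉ s, t ℓ ξ < t ℓ ζ)

/-- A sequence of linear orders is entangled if it is `κ`-entangled for `κ` the minimum of the
cardinalities of its members. -/
def IsEntangled {ι : Type w} [LinearOrder ι] (I : ι → Type v)
    [∀ α, LinearOrder (I α)] : Prop :=
  IsKEntangled (sInf (Set.range fun α => #(I α))) I

/-- The sequence `I = ⟨I α : α < lam⟩` witnesses `Ens(κ, lam)`: it is entangled and consists of
linear orders of cardinality `κ`. -/
def WitnessesEns (κ lam : Cardinal.{u}) (I : lam.ord.ToType → Type u)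
    [∀ α, LinearOrder (I α)] : Prop :=
  IsEntangled I ∧ ∀ α, #(I α) = κ

/-! Fix an order `E` of size χ with a dense set `D` of size μ; a point outside `D` is determined by
its cut in `D`. By recursion on α < λ, choose `f α : κ → E` that meets, in fewer than κ indices
each, `D` and every set of points whose cut is computed by some `C ⊆ Dⁿ × D` from points in the
ranges of earlier `f β`. These sets have size at most κ and fewer than λ ≤ U(χ) of them arise at
each stage, so `exists_forall_mk_preimage_lt` supplies `f α`. The orders are `D ∪ range (f α)`.

If a pattern failed on κ many indices, then, inductively, the earlier coordinates would compute the
cut of the last one (`exists_code`), against the choice of the last function. This realizes each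
pattern by a pair in no prescribed index order; `exists_large_pair` spreads the pair over two sets
of size κ, which allows ζ < ξ. -/

/-- The order of `E` if `b` is true, and the reverse order otherwise. -/
def dirLT {E : Type u} [LinearOrder E] (b : Bool) (x y : E) : Prop :=
  if b then x < y else y < x

/-! ### Cuts of points outside a dense set -/

section Direction

variable {E : Type u} [LinearOrder E] {D : Set E} {b : Bool} {x y z : E}

theorem dirLT.trans (h : dirLT b x y) (h' : dirLT b y z) : dirLT b x z := by
  cases b
  · exact lt_trans (b := y) h' h
  · exact lt_trans (b := y) h h'

theorem dirLT.asymm (h : dirLT b x y) : ¬ dirLT b y x := by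
  cases b
  · exact lt_asymm (a := y) h
  · exact lt_asymm (a := x) h

theorem dirLT_or_dirLT_of_ne (b : Bool) (h : x ≠ y) : dirLT b x y ∨ dirLT b y x := by
  cases b
  · exact h.symm.lt_or_gt
  · exact h.lt_or_gt

/-- Points outside a dense set are strictly separated by it. -/
theorem IsOrderDense.exists_dirLT (hD : IsOrderDense D) (hx : x ∉ D) (hy : y ∉ D)
    (h : dirLT b x y) : ∃ d : D, dirLT b x d ∧ dirLT b (d : E) y := by
  have key : ∀ x y : E, x ∉ D → y ∉ D → x < y → ∃ d : D, x < d ∧ d < y := by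
    intro x y hx hy h
    obtain ⟨d, hd, h1, h2⟩ := hD x y h
    refine ⟨⟨d, hd⟩, h1.lt_of_ne ?_, h2.lt_of_ne ?_⟩
    · rintro rfl; exact hx hd
    · rintro rfl; exact hy hd
  cases b
  · obtain ⟨d, h1, h2⟩ := key y x hy hx h
    exact ⟨d, h2, h1⟩
  · exact key x y hx hy h

/-- A point outside a dense set is determined by its cut. -/
theorem IsOrderDense.eq_of_dirLT_iff (hD : IsOrderDense D) (hx : x ∉ D) (hy : y ∉ D)
    (h : ∀ d : D, dirLT b x d ↔ dirLT b y d) : x = y := by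
  by_contra hne
  rcases dirLT_or_dirLT_of_ne b hne with h' | h'
  · obtain ⟨d, h1, h2⟩ := hD.exists_dirLT hx hy h'
    exact h2.asymm ((h d).1 h1)
  · obtain ⟨d, h1, h2⟩ := hD.exists_dirLT hy hx h'
    exact h2.asymm ((h d).2 h1)

end Direction

/-! ### Computing one cut from others -/

section Codes

variable {E : Type u} [LinearOrder E]

/-- The points outside `D` whose cut in `D` is computed by the code `C` from a tuple in `∏ X i`. -/
def codeSet (D : Set E) {n : ℕ} (s : Fin n → Bool) (b : Bool) (C : Set ((Fin n → D) × D))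
    (X : Fin n → Set E) : Set E :=
  {y | y ∉ D ∧ ∃ x : Fin n → E, (∀ i, x i ∈ X i) ∧
    ∀ d : D, dirLT b y d ↔ ∃ e : Fin n → D, (∀ i, dirLT (s i) (e i : E) (x i)) ∧ (e, d) ∈ C}

/-- The indices of a witnessing tuple fix the cut, hence the point, so there are at most `#K ^ n`
points. -/
theorem mk_codeSet_le {D : Set E} (hD : IsOrderDense D) {n : ℕ} (s : Fin n → Bool) (b : Bool)
    (C : Set ((Fin n → D) × D)) {K : Type u} (hK : ℵ₀ ≤ #K) (g : Fin n → K → E) :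
    #(codeSet D s b C fun i => range (g i)) ≤ #K := by
  have hz : ∀ y : codeSet D s b C fun i => range (g i), ∃ z : Fin n → K, ∀ d : D,
      dirLT b y.1 d ↔ ∃ e : Fin n → D, (∀ i, dirLT (s i) (e i : E) (g i (z i))) ∧ (e, d) ∈ C := by
    rintro ⟨y, -, x, hx, h⟩
    choose z hz using id hx
    exact ⟨z, by simpa only [hz] using h⟩
  choose z hz using hz
  have hinj : Function.Injective z := by
    intro y y' h
    refine Subtype.ext (hD.eq_of_dirLT_iff (b := b) y.2.1 y'.2.1 fun d => ?_)
    rw [hz, hz, h]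
  refine (mk_le_of_injective hinj).trans ?_
  rw [mk_arrow]
  simpa using power_nat_le hK

variable {K : Type u}

theorem le_mk_diff {S T : Set K} (hK : ℵ₀ ≤ #K) (hS : #K ≤ #S) (hT : #T < #K) :
    #K ≤ #(S \ T : Set K) := by
  by_contra h
  have h1 := add_lt_of_lt hK (not_le.1 h) hT
  have h2 : #S ≤ #((S \ T) ∪ T : Set K) :=
    mk_le_mk_of_subset (by rw [sdiff_union_self]; exact subset_union_left)
  exact absurd (hS.trans (h2.trans (mk_union_le _ _))) (not_le.2 h1)

/-- If the last coordinate always goes the wrong way, then it is captured by a code set. -/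
theorem exists_code {D : Set E} (hD : IsOrderDense D) (hK : (#K).IsRegular) (hDK : #D < #K)
    {n : ℕ} (s : Fin n → Bool) (b : Bool) {U : Set K} (hU : #K ≤ #U)
    (x : K → Fin n → E) (y : K → E) (hx : ∀ ζ ∈ U, ∀ i, x ζ i ∉ D) (hy : ∀ ζ ∈ U, y ζ ∉ D)
    (ih : ∀ V ⊆ U, #K ≤ #V → ∃ ζ ∈ V, ∃ ξ ∈ V, ∀ i, dirLT (s i) (x ζ i) (x ξ i))
    (hno : ∀ ζ ∈ U, ∀ ξ ∈ U, (∀ i, dirLT (s i) (x ζ i) (x ξ i)) → ¬ dirLT b (y ζ) (y ξ)) :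
    ∃ C : Set ((Fin n → D) × D), ∃ V ⊆ U, #K ≤ #V ∧
      ∀ ζ ∈ V, y ζ ∈ codeSet D s b C fun i => (fun ζ => x ζ i) '' U := by
  -- The indices at which the code misses `d`. If `bad d` were large, `ih` would give a pair in it
  -- whose first member shows that the second is not bad.
  let bad : D → Set K := fun d =>
    {ζ | ζ ∈ U ∧ dirLT b (y ζ) d ∧
      ¬ ∃ ξ ∈ U, dirLT b (y ξ) d ∧ ∀ i, dirLT (s i) (x ξ i) (x ζ i)}
  have hbad : ∀ d, #(bad d) < #K := by
    intro d
    by_contra h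
    obtain ⟨ζ, hζ, ξ, hξ, hlt⟩ := ih (bad d) (fun _ h => h.1) (not_lt.1 h)
    exact hξ.2.2 ⟨ζ, hζ.1, hζ.2.1, hlt⟩
  have hbadU : #(⋃ d, bad d) < #K :=
    (card_iUnion_lt_iff_forall_of_isRegular hK hDK).2 hbad
  refine ⟨{p | ∃ ξ ∈ U, (∀ i, dirLT (s i) (x ξ i) (p.1 i)) ∧ dirLT b (y ξ) p.2},
    U \ ⋃ d, bad d, sdiff_subset,
    le_mk_diff hK.aleph0_le hU hbadU, ?_⟩
  · rintro ζ ⟨hζ, hζb⟩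
    refine ⟨hy ζ hζ, x ζ, fun i => ⟨ζ, hζ, rfl⟩, fun d => ⟨fun hd => ?_, ?_⟩⟩
    · have : ζ ∉ bad d := fun h => hζb (mem_iUnion.2 ⟨d, h⟩)
      have : ∃ ξ ∈ U, dirLT b (y ξ) d ∧ ∀ i, dirLT (s i) (x ξ i) (x ζ i) := by
        by_contra h
        exact this ⟨hζ, hd, h⟩
      obtain ⟨ξ, hξ, hξd, hlt⟩ := this
      choose e he he' using fun i => hD.exists_dirLT (hx ξ hξ i) (hx ζ hζ i) (hlt i)
      exact ⟨e, he', ξ, hξ, he, hξd⟩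
    · rintro ⟨e, he, ξ, hξ, hξe, hξd⟩
      -- Were `d` before `y ζ`, then `ξ, ζ` would realize the pattern excluded by `hno`.
      rcases dirLT_or_dirLT_of_ne b (show y ζ ≠ d from fun h => hy ζ hζ (h ▸ d.2)) with h | h
      · exact h
      · exact absurd (hξd.trans h) (hno ξ hξ ζ hζ fun i => (hξe i).trans (he i))

/-- Each `f α` meets each code set over finitely many earlier `f β` in few indices. -/
def AvoidsCodes {ι : Type u} [LinearOrder ι] (D : Set E) (f : ι → K → E) : Prop :=
  ∀ (α : ι) (n : ℕ) (a : Fin n → Iio α) (s : Fin n → Bool) (b : Bool)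
    (C : Set ((Fin n → D) × D)),
    #{i | f α i ∈ codeSet D s b C fun j => range (f (a j))} < #K

/-- Induction on `n`, removing the largest index, since codes refer only to earlier functions. The
pair found carries no information on the order of `ζ` and `ξ`. -/
theorem AvoidsCodes.exists_dirLT {ι : Type u} [LinearOrder ι] {D : Set E} (hD : IsOrderDense D)
    (hK : (#K).IsRegular) (hDK : #D < #K) {f : ι → K → E} (hf : AvoidsCodes D f) :
    ∀ (n : ℕ) (a : Fin n → ι), StrictMono a → ∀ (s : Fin n → Bool) (U : Set K), #K ≤ #U →
      ∀ t : K → Fin n → E, (∀ ζ ∈ U, ∀ i, t ζ i ∉ D) → (∀ i, InjOn (fun ζ => t ζ i) U) →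
      (∀ ζ ∈ U, ∀ i, t ζ i ∈ range (f (a i))) →
      ∃ ζ ∈ U, ∃ ξ ∈ U, ∀ i, dirLT (s i) (t ζ i) (t ξ i) := by
  intro n
  induction n with
  | zero =>
    intro a _ s U hU t _ _ _
    obtain ⟨ζ, hζ⟩ := nonempty_coe_sort.1 (mk_ne_zero_iff.1 (hK.pos.trans_le hU).ne')
    exact ⟨ζ, hζ, ζ, hζ, fun i => i.elim0⟩
  | succ n ih =>
    intro a ha s U hU t htD htinj htf
    by_contra hno
    push Not at hno
    obtain ⟨C, V, hVU, hV, hC⟩ := exists_code hD hK hDK (fun i => s i.castSucc) (s (Fin.last n)) hU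
      (fun ζ i => t ζ i.castSucc) (fun ζ => t ζ (Fin.last n)) (fun ζ hζ i => htD ζ hζ _)
      (fun ζ hζ => htD ζ hζ _)
      (fun V hVU hV => ih (fun i => a i.castSucc) (ha.comp Fin.strictMono_castSucc)
        (fun i => s i.castSucc) V hV (fun ζ i => t ζ i.castSucc) (fun ζ hζ i => htD ζ (hVU hζ) _)
        (fun i => (htinj i.castSucc).mono hVU) (fun ζ hζ i => htf ζ (hVU hζ) _))
      (fun ζ hζ ξ hξ h h' => by
        obtain ⟨i, hi⟩ := hno ζ hζ ξ hξ
        exact hi (Fin.lastCases (motive := fun i => dirLT (s i) (t ζ i) (t ξ i)) h' h i))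
    have hlt := hf (a (Fin.last n)) n (fun i => ⟨a i.castSucc, ha (Fin.castSucc_lt_last i)⟩)
      (fun i => s i.castSucc) (s (Fin.last n)) C
    choose p hp using fun ζ : V => htf ζ (hVU ζ.2) (Fin.last n)
    refine absurd (hV.trans ?_) (not_le.2 hlt)
    refine mk_le_of_injective (f := fun ζ : V => ⟨p ζ, ?_⟩) ?_
    · obtain ⟨h1, x, hx, h2⟩ := hC ζ ζ.2
      refine mem_ofPred.2 ?_
      rw [hp]
      refine ⟨h1, x, fun i => ?_, h2⟩
      obtain ⟨ξ, hξ, h⟩ := hx i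
      exact h ▸ htf ξ hξ _
    · intro ζ ξ h
      refine Subtype.ext (htinj (Fin.last n) (hVU ζ.2) (hVU ξ.2) ?_)
      have := congrArg (f (a (Fin.last n))) (congrArg Subtype.val h)
      simpa only [hp] using this

end Codes

/-! ### Freeing the order of the two indices -/

section Accumulation

variable {E : Type u} [LinearOrder E] {K : Type u}

/-- If every large set of indices contains a pair of type `s`, then the two members of such
pairs can be taken from two fixed large sets. -/
theorem exists_large_pair {D : Set E} (hD : IsOrderDense D) (hK : (#K).IsRegular) (hDK : #D < #K)
    {n : ℕ} (s : Fin n → Bool) {U : Set K} (hU : #K ≤ #U) (t : K → Fin n → E)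
    (htD : ∀ ζ ∈ U, ∀ i, t ζ i ∉ D)
    (h : ∀ V ⊆ U, #K ≤ #V → ∃ ζ ∈ V, ∃ ξ ∈ V, ∀ i, dirLT (s i) (t ζ i) (t ξ i)) :
    ∃ V W : Set K, #K ≤ #V ∧ #K ≤ #W ∧
      ∀ ζ ∈ V, ∀ ξ ∈ W, ∀ i, dirLT (s i) (t ζ i) (t ξ i) := by
  let lower : (Fin n → D) → Set K := fun e => {ζ | ∀ i, dirLT (s i) (t ζ i) (e i)}
  let upper : (Fin n → D) → Set K := fun e => {ζ | ∀ i, dirLT (s i) (e i : E) (t ζ i)}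
  have hDn : #(Fin n → D) < #K := by
    rw [mk_arrow]
    simp only [mk_fin, lift_uzero, lift_natCast]
    rcases lt_or_ge #D ℵ₀ with hfin | hinf
    · exact (power_lt_aleph0 hfin natCast_lt_aleph0).trans_le hK.aleph0_le
    · exact (power_nat_le hinf).trans_lt hDK
  have small (B : (Fin n → D) → Set K) : #(⋃ e : {e // #(B e) < #K}, B e) < #K :=
    (card_iUnion_lt_iff_forall_of_isRegular hK ((mk_subtype_le _).trans_lt hDn)).2 fun e => e.2
  obtain ⟨ζ, hζ, ξ, hξ, hlt⟩ := h _ (sdiff_subset.trans sdiff_subset)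
    (le_mk_diff hK.aleph0_le (le_mk_diff hK.aleph0_le hU (small lower)) (small upper))
  choose e he he' using fun i => hD.exists_dirLT (htD ζ hζ.1.1 i) (htD ξ hξ.1.1 i) (hlt i)
  refine ⟨lower e, upper e, ?_, ?_, fun ζ hζ ξ hξ i => (hζ i).trans (hξ i)⟩
  · by_contra h
    exact hζ.1.2 (mem_iUnion.2 ⟨⟨e, not_le.1 h⟩, he⟩)
  · by_contra h
    exact hξ.2 (mem_iUnion.2 ⟨⟨e, not_le.1 h⟩, he'⟩)

end Accumulation

/-! ### The recursive choice of functions -/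

section Construction

theorem mk_Iio_ord_lt {c : Cardinal.{u}} (i : c.ord.ToType) : #(Iio i) < c := by
  simpa using mk_Iio_lt i (by simp)

theorem exists_forall_restrict_Iio {ι : Type u} {X : Type v} [LinearOrder ι] [WellFoundedLT ι]
    (P : ∀ α : ι, (Iio α → X) → X → Prop) (h : ∀ α g, ∃ x, P α g x) :
    ∃ f : ι → X, ∀ α, P α (fun β => f β) (f α) := by
  choose F hF using h
  refine ⟨wellFounded_lt.fix fun α g => F α fun β => g β.1 β.2, fun α => ?_⟩
  rw [WellFounded.fix_eq]
  exact hF _ _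

/-- Fewer than `U_J(χ)` sets of size at most `κ` are avoided by a single function. -/
theorem exists_forall_mk_preimage_lt {E J : Type u} {κ : Cardinal.{u}} (hκ : ℵ₀ ≤ κ) (hκE : κ ≤ #E)
    (S : J → Set E) (hS : ∀ j, #(S j) ≤ κ)
    (hJ : #J < coveringU (boundedIdeal κ.ord.ToType) #E) :
    ∃ f : κ.ord.ToType → E, ∀ j, #{i | f i ∈ S j} < κ := by
  obtain ⟨e⟩ : Nonempty (E ≃ (#E).ord.ToType) := Cardinal.eq.1 (mk_ord_toType _).symm
  obtain ⟨p, -, hp⟩ := le_mk_iff_exists_subset.1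
    (show κ ≤ #(univ : Set (#E).ord.ToType) by rwa [mk_univ, mk_ord_toType])
  -- Covering families consist of sets of size exactly κ, hence the padding by `p`.
  let A : J → Set (#E).ord.ToType := fun j => e '' S j ∪ p
  have hA : ∀ j, #(A j) = κ := by
    intro j
    refine le_antisymm ((mk_union_le _ _).trans ?_) ?_
    · exact add_le_of_le hκ (mk_image_le.trans (hS j)) hp.le
    · exact hp.ge.trans (mk_le_mk_of_subset subset_union_right)
  by_contra! hno
  refine absurd (csInf_le' ?_) (not_le.2 (mk_range_le.trans_lt hJ : #(range A) < _))
  refine ⟨range A, rfl, ?_, fun f => ?_⟩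
  · rintro _ ⟨j, rfl⟩
    rw [hA, mk_ord_toType]
  · obtain ⟨j, hj⟩ := hno fun i => e.symm (f i)
    refine ⟨A j, mem_range_self j, fun hmem => ?_⟩
    have hsub : {i | e.symm (f i) ∈ S j} ⊆ {i | f i ∈ A j} := fun i hi =>
      Or.inl ⟨_, hi, e.apply_symm_apply _⟩
    refine absurd (hj.trans (mk_le_mk_of_subset hsub)) (not_le.2 ?_)
    rcases hmem with h | ⟨a, ha⟩
    · rw [h, mk_eq_zero]
      exact aleph0_pos.trans_le hκ
    · exact (mk_le_mk_of_subset (t := Iio a) ha).trans_lt (mk_Iio_ord_lt a)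

theorem mk_codes_lt {E : Type u} {D : Set E} {J : Type u} {lam : Cardinal.{u}}
    (hD : ℵ₀ ≤ #D) (hlam : 2 ^ #D < lam) (hJ : #J < lam) :
    #(Option (Σ n : ℕ, (Fin n → J) × (Fin n → Bool) × Bool × Set ((Fin n → D) × D))) < lam := by
  have hm : ℵ₀ ≤ max (2 ^ #D) #J := hD.trans ((cantor _).le.trans (le_max_left _ _))
  refine lt_of_le_of_lt ?_ (max_lt hlam hJ)
  rw [mk_option, mk_sigma]
  refine add_le_of_le hm ?_ (one_le_aleph0.trans hm)
  refine (sum_le_sum _ (fun _ => max (2 ^ #D) #J) fun n => ?_).trans ?_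
  · simp only [mk_prod, lift_id, lift_uzero]
    refine mul_le_of_le hm ?_ (mul_le_of_le hm ?_ (mul_le_of_le hm ?_ ?_))
    · rw [mk_arrow]
      simpa using (power_le_power_right (c := n) (le_max_right (2 ^ #D) #J)).trans (power_nat_le hm)
    · refine le_trans ?_ hm
      simpa using (lt_aleph0_of_finite (Fin n → Bool)).le
    · simpa using (natCast_lt_aleph0 (n := 2)).le.trans hm
    · rw [mk_set]
      refine le_trans ?_ (le_max_left _ _)
      refine power_le_power_left two_ne_zero ?_
      rw [mk_prod, lift_id, lift_id, mk_arrow]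
      refine mul_le_of_le hD ?_ le_rfl
      simpa using power_nat_le hD
  · rw [sum_const]
    simpa using mul_le_of_le hm hm le_rfl

theorem exists_avoidsCodes {E : Type u} [LinearOrder E] {D : Set E} (hD : IsOrderDense D)
    {κ lam : Cardinal.{u}} (hDinf : ℵ₀ ≤ #D) (hDκ : #D < κ) (hκE : κ ≤ #E) (hlam : 2 ^ #D < lam)
    (hU : lam ≤ coveringU (boundedIdeal κ.ord.ToType) #E) :
    ∃ f : lam.ord.ToType → κ.ord.ToType → E, AvoidsCodes D f ∧ ∀ α, #{i | f α i ∈ D} < κ := by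
  have hκ : ℵ₀ ≤ κ := hDinf.trans hDκ.le
  let P : ∀ α : lam.ord.ToType, (Iio α → κ.ord.ToType → E) → (κ.ord.ToType → E) → Prop :=
    fun α g x => (∀ (n : ℕ) (a : Fin n → Iio α) (s : Fin n → Bool) (b : Bool)
      (C : Set ((Fin n → D) × D)),
        #{i | x i ∈ codeSet D s b C fun j => range (g (a j))} < κ) ∧ #{i | x i ∈ D} < κ
  obtain ⟨f, hf⟩ := exists_forall_restrict_Iio P fun α g => by
    obtain ⟨x, hx⟩ := exists_forall_mk_preimage_lt hκ hκE
      -- The value `none` stands for `D` itself, which must be avoided too.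
      (fun o : Option (Σ n : ℕ, (Fin n → Iio α) × (Fin n → Bool) × Bool ×
          Set ((Fin n → D) × D)) => o.elim D fun c =>
        codeSet D c.2.2.1 c.2.2.2.1 c.2.2.2.2 fun j => range (g (c.2.1 j)))
      (by
        rintro (_ | c)
        · exact hDκ.le
        · refine (mk_codeSet_le hD _ _ _ ?_ _).trans_eq (mk_ord_toType κ)
          rwa [mk_ord_toType])
      ((mk_codes_lt hDinf hlam (mk_Iio_ord_lt α)).trans_le hU)
    exact ⟨x, fun n a s b C => hx (some ⟨n, a, s, b, C⟩), hx none⟩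
  refine ⟨f, fun α n a s b C => ?_, fun α => (hf α).2⟩
  rw [mk_ord_toType]
  exact (hf α).1 n a s b C

end Construction

/-! ### Cardinality and entanglement -/

section Members

variable {E : Type u} [LinearOrder E] {D : Set E} {κ : Cardinal.{u}}

/-- A function avoiding the codes of length zero has few repetitions. -/
theorem AvoidsCodes.mk_range {ι : Type u} [LinearOrder ι] (hκ : κ.IsRegular) (hDκ : #D < κ)
    {f : ι → κ.ord.ToType → E} (hf : AvoidsCodes D f) (hfD : ∀ α, #{i | f α i ∈ D} < κ) (α : ι) :
    #(D ∪ range (f α) : Set E) = κ := by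
  have hrange : #(range (f α)) ≤ κ := mk_range_le.trans_eq (mk_ord_toType κ)
  refine le_antisymm ((mk_union_le _ _).trans (add_le_of_le hκ.aleph0_le hDκ.le hrange)) ?_
  by_contra! hlt
  have hcover : (⋃ y : (D ∪ range (f α) : Set E), {i | f α i = y}) = Set.univ :=
    eq_univ_of_forall fun i => mem_iUnion.2 ⟨⟨f α i, Or.inr ⟨i, rfl⟩⟩, rfl⟩
  have : #(⋃ y : (D ∪ range (f α) : Set E), {i | f α i = y}) < κ := by
    refine (card_iUnion_lt_iff_forall_of_isRegular hκ hlt).2 fun y => ?_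
    by_cases hy : (y : E) ∈ D
    · refine (mk_le_mk_of_subset ?_).trans_lt (hfD α)
      intro i hi
      rw [mem_ofPred_eq] at hi ⊢
      rwa [hi]
    -- The length-zero code listing the cut of `y` defines exactly `{y}`.
    · have := hf α 0 Fin.elim0 Fin.elim0 true {p | (y : E) < p.2}
      rw [mk_ord_toType] at this
      refine (mk_le_mk_of_subset ?_).trans_lt this
      intro i hi
      simp only [mem_ofPred_eq] at hi ⊢
      rw [hi]
      refine ⟨hy, Fin.elim0, fun i => i.elim0, fun d => ?_⟩
      exact ⟨fun h => ⟨Fin.elim0, fun i => i.elim0, h⟩, fun ⟨_, _, h⟩ => h⟩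
  rw [hcover, mk_univ, mk_ord_toType] at this
  exact lt_irrefl _ this

theorem AvoidsCodes.isKEntangled {ι : Type u} [LinearOrder ι] (hD : IsOrderDense D)
    (hκ : κ.IsRegular) (hDκ : #D < κ)
    {f : ι → κ.ord.ToType → E} (hf : AvoidsCodes D f) (hfD : ∀ α, #{i | f α i ∈ D} < κ) :
    IsKEntangled κ fun α => (D ∪ range (f α) : Set E) := by
  classical
  have hK : #κ.ord.ToType = κ := mk_ord_toType κ
  have hKr : (#κ.ord.ToType).IsRegular := by rwa [hK]
  have hDK : #D < #κ.ord.ToType := by rwa [hK]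
  refine ⟨fun α => (hf.mk_range hκ hDκ hfD α).ge, fun n a ha t ht s => ?_⟩
  let T : κ.ord.ToType → Fin n → E := fun ζ i => t i ζ
  have hTinj : ∀ i, Function.Injective fun ζ => T ζ i := fun i =>
    Subtype.val_injective.comp (ht i)
  let σ : Fin n → Bool := fun i => decide (i ∈ s)
  have hbad : #(⋃ i : ULift.{u} (Fin n), {ζ | T ζ i.down ∈ D}) < #κ.ord.ToType := by
    refine (card_iUnion_lt_iff_forall_of_isRegular hKr ?_).2 fun i => ?_
    · exact (lt_aleph0_of_finite _).trans_le hKr.aleph0_le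
    · refine lt_of_le_of_lt (mk_preimage_of_injective _ D (hTinj i.down)) hDK
  let U : Set κ.ord.ToType := univ \ ⋃ i : ULift.{u} (Fin n), {ζ | T ζ i.down ∈ D}
  have hU : #κ.ord.ToType ≤ #U := le_mk_diff hKr.aleph0_le mk_univ.ge hbad
  have hUD : ∀ ζ ∈ U, ∀ i, T ζ i ∉ D := fun ζ hζ i h => hζ.2 (mem_iUnion.2 ⟨⟨i⟩, h⟩)
  obtain ⟨V, W, hV, hW, hVW⟩ := exists_large_pair hD hKr hDK σ hU T hUD fun V hVU hV =>
    hf.exists_dirLT hD hKr hDK n a ha σ V hV T (fun ζ hζ => hUD ζ (hVU hζ))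
      (fun i => (hTinj i).injOn) fun ζ hζ i => (t i ζ).2.resolve_left (hUD ζ (hVU hζ) i)
  obtain ⟨ζ, hζ⟩ := nonempty_coe_sort.1 (mk_ne_zero_iff.1 (hKr.pos.trans_le hV).ne')
  have : ¬ W ⊆ Iic ζ := by
    intro h
    have h1 : #(Iic ζ) < κ := by
      rw [← Iio_insert]
      refine mk_insert_le.trans_lt (add_lt_of_lt hκ.aleph0_le (mk_Iio_ord_lt ζ) ?_)
      exact one_lt_aleph0.trans_le hκ.aleph0_le
    exact absurd (hW.trans (mk_le_mk_of_subset h)) (not_le.2 (h1.trans_eq hK.symm))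
  obtain ⟨ξ, hξ, hlt⟩ := not_subset.1 this
  refine ⟨ζ, ξ, not_le.1 hlt, fun i hi => ?_, fun i hi => ?_⟩
  · have := hVW ζ hζ ξ hξ i
    simpa [dirLT, σ, hi, T] using this
  · have := hVW ζ hζ ξ hξ i
    simpa [dirLT, σ, hi, T] using this

end Members

/-! ### Density and the ambient order -/

section Density

theorem exists_isOrderDense_mk_eq (L : Type u) [LinearOrder L] :
    ∃ D : Set L, IsOrderDense D ∧ #D = orderDensity L :=
  csInf_mem (s := {θ : Cardinal.{u} | ∃ D : Set L, IsOrderDense D ∧ #D = θ})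
    ⟨_, univ, fun x _ h => ⟨x, mem_univ x, le_rfl, h.le⟩, rfl⟩

theorem finite_of_isOrderDense_finite {L : Type u} [LinearOrder L] {D : Set L}
    (hD : IsOrderDense D) (hfin : D.Finite) : Finite L := by
  have : Finite D := hfin
  have : Finite (Dᶜ : Set L) := by
    refine Finite.of_injective (fun x : (Dᶜ : Set L) => {d : D | dirLT true x.1 d}) fun x y h => ?_
    exact Subtype.ext (hD.eq_of_dirLT_iff (b := true) x.2 y.2 fun d => Set.ext_iff.1 h d)
  rw [← finite_univ_iff, ← union_compl_self D]
  exact hfin.union this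

/-- An order containing `#T` separated nontrivial intervals has density at least `#T`. -/
theorem mk_le_orderDensity {T I : Type u} [LinearOrder T] [LinearOrder I] (l r : T → I)
    (hlr : ∀ a, l a < r a) (hsep : ∀ a b, a < b → r a < l b) : #T ≤ orderDensity I := by
  obtain ⟨D, hD, hDI⟩ := exists_isOrderDense_mk_eq I
  rw [← hDI]
  choose d hd h1 h2 using fun a => hD _ _ (hlr a)
  have hmono : StrictMono d := fun a b h => (h2 a).trans_lt ((hsep a b h).trans_le (h1 b))
  exact mk_le_of_injective (f := fun a => (⟨d a, hd a⟩ : D))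
    fun a b h => hmono.injective (congrArg Subtype.val h)

end Density

/-- Below `Ded⁺(μ)` there are orders with a dense set of size `μ` containing `μ` separated
intervals. -/
theorem exists_order_of_lt_dedPlus {μ χ : Cardinal.{u}} (hμχ : μ < χ) (hχ : χ < dedPlus μ)
    (hχinf : ℵ₀ ≤ χ) :
    ∃ (E : Type u) (_ : LinearOrder E) (D : Set E) (l r : μ.ord.ToType → D),
      #E = χ ∧ IsOrderDense D ∧ ℵ₀ ≤ μ ∧ #D = μ ∧ (∀ a, l a < r a) ∧ ∀ a b, a < b → r a < l b := by
  obtain ⟨L, _, hL, hLμ⟩ := not_not.1 (notMem_of_lt_csInf' hχ)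
  obtain ⟨D₀, hD₀, hD₀L⟩ := exists_isOrderDense_mk_eq L
  have hD₀μ : #D₀ ≤ μ := hD₀L.trans_le hLμ
  have hμ : ℵ₀ ≤ μ := by
    by_contra! h
    have := finite_of_isOrderDense_finite hD₀ (lt_aleph0_iff_set_finite.1 (hD₀μ.trans_lt h))
    exact absurd (lt_aleph0_of_finite L) (not_lt.2 (hL.symm ▸ hχinf))
  -- Prefixing μ two-point blocks makes the dense set have size exactly μ and keeps the density of
  -- every suborder containing it from dropping below μ.
  let T := μ.ord.ToType
  have hTB : #(T ×ₗ Bool) = μ := by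
    change #(T × Bool) = μ
    rw [mk_prod, lift_uzero, mk_ord_toType, mk_bool]
    simpa using mul_eq_left hμ ((natCast_lt_aleph0 (n := 2)).le.trans hμ) two_ne_zero
  let inl : T ×ₗ Bool → (T ×ₗ Bool) ⊕ₗ L := fun x => toLex (Sum.inl x)
  let inr : L → (T ×ₗ Bool) ⊕ₗ L := fun x => toLex (Sum.inr x)
  have hinl : StrictMono inl := fun _ _ h => Sum.Lex.inl_lt_inl_iff.2 h
  let D : Set ((T ×ₗ Bool) ⊕ₗ L) := range inl ∪ inr '' D₀
  refine ⟨(T ×ₗ Bool) ⊕ₗ L, inferInstance, D,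
    fun a => ⟨inl (toLex (a, false)), Or.inl ⟨_, rfl⟩⟩,
    fun a => ⟨inl (toLex (a, true)), Or.inl ⟨_, rfl⟩⟩, ?_, ?_, hμ, ?_, ?_, ?_⟩
  · change #((T ×ₗ Bool) ⊕ L) = χ
    rw [mk_sum, lift_id, lift_id, hTB, hL, add_eq_right hχinf hμχ.le]
  · intro x y hxy
    induction x using Lex.rec with | _ x
    induction y using Lex.rec with | _ y
    rcases x with x | x
    · exact ⟨inl x, Or.inl ⟨x, rfl⟩, le_rfl, hxy.le⟩
    · rcases y with y | y
      · exact absurd hxy Sum.Lex.not_inr_lt_inl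
      · obtain ⟨d, hd, h1, h2⟩ := hD₀ x y (Sum.Lex.inr_lt_inr_iff.1 hxy)
        exact ⟨inr d, Or.inr ⟨d, hd, rfl⟩, Sum.Lex.inr_le_inr_iff.2 h1, Sum.Lex.inr_le_inr_iff.2 h2⟩
  · have hrange : #(range inl) = μ := (mk_range_eq inl hinl.injective).trans hTB
    refine le_antisymm ((mk_union_le _ _).trans ?_) ?_
    · exact add_le_of_le hμ hrange.le (mk_image_le.trans hD₀μ)
    · exact hrange.ge.trans (mk_le_mk_of_subset subset_union_left)
  · intro a
    exact hinl (Prod.Lex.toLex_lt_toLex.2 (Or.inr ⟨rfl, Bool.false_lt_true⟩))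
  · intro a b h
    exact hinl (Prod.Lex.toLex_lt_toLex.2 (Or.inl h))

theorem theorem3p1 (μ κ χ lam : Cardinal.{u})
    (hμκ : μ < κ) (hκχ : κ < χ) (hχ : χ < dedPlus μ)
    (hlam : 2 ^ μ < lam) (hκ : κ.IsRegular)
    (hU : lam ≤ coveringU (boundedIdeal κ.ord.ToType) χ) :
    ∃ (I : lam.ord.ToType → Type u) (_ : ∀ α, LinearOrder (I α)),
      WitnessesEns κ lam I ∧ ∀ α, orderDensity (I α) = μ := by
  obtain ⟨E, _, D, l, r, rfl, hD, hμ, rfl, hlr, hsep⟩ :=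
    exists_order_of_lt_dedPlus (hμκ.trans hκχ) hχ (hκ.aleph0_le.trans hκχ.le)
  obtain ⟨f, hf, hfD⟩ := exists_avoidsCodes hD hμ hμκ hκχ.le hlam hU
  have hcard := hf.mk_range hκ hμκ hfD
  refine ⟨fun α => (D ∪ range (f α) : Set E), fun α => inferInstance, ⟨?_, hcard⟩, fun α => ?_⟩
  -- Over an empty index set the infimum of the cardinalities would be 0, not κ.
  · have : Nonempty lam.ord.ToType := by
      rw [← mk_ne_zero_iff, mk_ord_toType]
      exact (zero_le.trans_lt hlam).ne'
    rw [IsEntangled, funext hcard, range_const, csInf_singleton]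
    exact hf.isKEntangled hD hκ hμκ hfD
  · refine le_antisymm ?_ ?_
    · let D' : Set (D ∪ range (f α) : Set E) := range (inclusion subset_union_left)
      have hD' : IsOrderDense D' := by
        intro x y h
        obtain ⟨d, hd, h1, h2⟩ := hD x y h
        exact ⟨⟨d, Or.inl hd⟩, ⟨⟨d, hd⟩, rfl⟩, h1, h2⟩
      have hle : orderDensity (D ∪ range (f α) : Set E) ≤ #D' := csInf_le' ⟨D', hD', rfl⟩
      exact hle.trans mk_range_le
    · have := mk_le_orderDensity (fun a => inclusion (subset_union_left (t := range (f α))) (l a))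
        (fun a => inclusion subset_union_left (r a)) hlr hsep
      rwa [mk_ord_toType] at this
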